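/- Let $(G(n),K(n))_{n\ge 1}$ be an increasing sequence of Gelfand pairs: each $G(n)$ is a locally compact Hausdorff topological group which is a closed (topological) subgroup of $G(n+1)$, each $K(n)$ is a compact subgroup of $G(n)$ such that the convolution algebra of $K(n)$-biinvariant integrable functions on $G(n)$ (with respect to left Haar measure) is commutative, and $K(n)=K(n+1)\cap G(n)$ for all $n$. Let $G=\bigcup_{n}G(n)$, equipped with the inductive limit topology (the finest topology for which all embeddings $G(n)\to G$ are continuous), and let $K=\bigcup_n K(n)$; the pair $(G,K)$ is called an Olshanski spherical pair. Let $\mathcal P^{\natural}(G)$ be the convex cone of all continuous functions $\varphi:G\to\mathbb C$ which are $K$-biinvariant, i.e. $\varphi(k_1gk_2)=\varphi(g)$ for all $k_1,k_2\in K$, $g\in G$, and of positive type, i.e. $\sum_{i,j=1}^m c_i\overline{c_j}\,\varphi(g_j^{-1}g_i)\ge 0$ for all $m$, all $g_1,\dots,g_m\in G$ and all $c_1,\dots,c_m\in\mathbb C$. Order $\mathcal P^{\natural}(G)$ by $\varphi\ll\psi$ if and only if $\psi-\varphi\in\mathcal P^{\natural}(G)$. Then $\mathcal P^{\natural}(G)$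 is a lattice: any two elements of $\mathcal P^{\natural}(G)$ have a least upper bound and a greatest lower bound in $\mathcal P^{\natural}(G)$ for the order $\ll$. -/

import Mathlib

open MeasureTheory Topology
open scoped ComplexOrder ComplexConjugate

/-- A function `φ : G → ℂ` is of positive type if `∑ i, ∑ j, c i * conj (c j) * φ ((g j)⁻¹ * g i)`
is real and nonnegative for all finite families `g` in `G` and `c` in `ℂ`. -/
def IsPositiveType {G : Type*} [Group G] (φ : G → ℂ) : Prop :=
  ∀ (n : ℕ) (g : Fin n → G) (c : Fin n → ℂ),
    0 ≤ ∑ i, ∑ j, c i * conj (c j) * φ ((g j)⁻¹ * g i)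

/-- `f (k₁ * g * k₂) = f g` for all `k₁ k₂ ∈ K` and all `g`. -/
def IsBiinvariant {G : Type*} [Group G] (K : Subgroup G) (f : G → ℂ) : Prop :=
  ∀ k₁ ∈ K, ∀ k₂ ∈ K, ∀ g : G, f (k₁ * g * k₂) = f g

/-- The convex cone of `K`-biinvariant continuous functions of positive type on `G`. -/
def positiveTypeCone {G : Type*} [Group G] [TopologicalSpace G] (K : Subgroup G) :
    ConvexCone ℝ (G → ℂ) where
  carrier := {φ | Continuous φ ∧ IsBiinvariant K φ ∧ IsPositiveType φ}
  smul_mem' := by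
    rintro r hr φ ⟨hc, hb, hp⟩
    refine ⟨hc.const_smul r, fun k₁ h₁ k₂ h₂ g => ?_, fun n g c => ?_⟩
    · simp only [Pi.smul_apply, hb k₁ h₁ k₂ h₂ g]
    · have h := mul_nonneg (Complex.zero_le_real.2 hr.le) (hp n g c)
      rw [Finset.mul_sum] at h
      simp only [Finset.mul_sum] at h
      refine h.trans_eq (Finset.sum_congr rfl fun i _ => Finset.sum_congr rfl fun j _ => ?_)
      simp only [Pi.smul_apply, Complex.real_smul]
      ring
  add_mem' := by
    rintro φ ⟨hc, hb, hp⟩ ψ ⟨hc', hb', hp'⟩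
    refine ⟨hc.add hc', fun k₁ h₁ k₂ h₂ g => ?_, fun n g c => ?_⟩
    · simp only [Pi.add_apply, hb k₁ h₁ k₂ h₂ g, hb' k₁ h₁ k₂ h₂ g]
    · have h := add_nonneg (hp n g c) (hp' n g c)
      simpa only [Pi.add_apply, mul_add, Finset.sum_add_distrib] using h

/-- The order defined by a cone: `x ≪ y` if `y - x` belongs to the cone. -/
def ConeLE {E : Type*} [AddCommGroup E] [Module ℝ E] (Γ : ConvexCone ℝ E) (x y : E) : Prop :=
  y - x ∈ Γ

/-- A cone is a lattice if any two of its elements have, inside the cone and for the order defined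
by the cone, a least upper bound and a greatest lower bound. -/
def IsLatticeCone {E : Type*} [AddCommGroup E] [Module ℝ E] (Γ : ConvexCone ℝ E) : Prop :=
  ∀ x ∈ Γ, ∀ y ∈ Γ,
    (∃ s ∈ Γ, ConeLE Γ x s ∧ ConeLE Γ y s ∧
      ∀ t ∈ Γ, ConeLE Γ x t → ConeLE Γ y t → ConeLE Γ s t) ∧
    (∃ m ∈ Γ, ConeLE Γ m x ∧ ConeLE Γ m y ∧
      ∀ t ∈ Γ, ConeLE Γ t x → ConeLE Γ t y → ConeLE Γ t m)

/-- The convolution `(f * g) x = ∫ f y * g (y⁻¹ * x) dy` for the left Haar measure. -/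
noncomputable def haarConvolution {H : Type*} [Group H] [TopologicalSpace H]
    [IsTopologicalGroup H] [LocallyCompactSpace H] [MeasurableSpace H] [BorelSpace H]
    (f g : H → ℂ) (x : H) : ℂ :=
  ∫ y, f y * g (y⁻¹ * x) ∂(Measure.haar : Measure H)

/-- For a locally compact group `H` and a subgroup `M`, the pair `(H, M)` is a Gelfand pair if `M`
is compact and the convolution algebra of `M`-biinvariant integrable functions is commutative
(an identity in `L¹`, that is, almost everywhere). -/
structure IsGelfandPair {H : Type*} [Group H] [TopologicalSpace H]
    [IsTopologicalGroup H] [LocallyCompactSpace H] [MeasurableSpace H] [BorelSpace H]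
    (M : Subgroup H) : Prop where
  isCompact : IsCompact (M : Set H)
  convolution_comm : ∀ f g : H → ℂ, IsBiinvariant M f → IsBiinvariant M g →
    Integrable f (Measure.haar : Measure H) → Integrable g (Measure.haar : Measure H) →
      haarConvolution f g =ᵐ[(Measure.haar : Measure H)] haarConvolution g f

/-- The pair `(G, K)` is the Olshanski spherical pair defined by the increasing sequence of Gelfand
pairs `(H n, L n)` with inclusions `ι n : H n →* H (n + 1)`: each `H n` is a closed topological
subgroup of `H (n + 1)`, with `L n = L (n + 1) ∩ H n`, and `G` and `K` are the unions of the `H n`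
and of the `L n` (along the injective, compatible embeddings `j n : H n →* G`), where `G` has the
inductive limit topology. -/
structure IsOlshanskiSphericalPair {H : ℕ → Type*} [∀ n, Group (H n)]
    [∀ n, TopologicalSpace (H n)] [∀ n, IsTopologicalGroup (H n)]
    [∀ n, LocallyCompactSpace (H n)] [∀ n, MeasurableSpace (H n)] [∀ n, BorelSpace (H n)]
    (L : ∀ n, Subgroup (H n)) (ι : ∀ n, H n →* H (n + 1))
    {G : Type*} [Group G] [TopologicalSpace G] (j : ∀ n, H n →* G) (K : Subgroup G) : Prop where
  isGelfandPair : ∀ n, IsGelfandPair (L n)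
  isClosedEmbedding : ∀ n, IsClosedEmbedding (ι n)
  comap_eq : ∀ n, (L (n + 1)).comap (ι n) = L n
  compatible : ∀ n, (j (n + 1)).comp (ι n) = j n
  injective : ∀ n, Function.Injective (j n)
  exists_eq : ∀ x : G, ∃ n, ∃ y : H n, j n y = x
  isOpen_iff : ∀ U : Set G, IsOpen U ↔ ∀ n, IsOpen (j n ⁻¹' U)
  mem_iff : ∀ x : G, x ∈ K ↔ ∃ n, ∃ y ∈ L n, j n y = x

/-!
The order on the cone is analysed through operators. Given `ω` in the cone, the GNS construction
gives a unitary representation `π` with a cyclic vector `v` fixed by `K` and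
`ω g = ⟪v, π g v⟫`. A function of positive type `ψ ≪ ω` is `g ↦ ⟪v, R (π g v)⟫` for a positive
operator `R` commuting with `π` (`CyclicRep.exists_coeff_eq`), and `R ↦ ⟪v, R (π g v)⟫`
preserves and reflects positivity (`CyclicRep.IsIntertwiner.isPositiveType_coeff_iff`).

The Gelfand hypothesis enters only to show that the self-adjoint intertwiners commute with each
other. In a Gelfand pair `(H, M)`, commutativity of the convolution algebra means that
`∫ f (g k h) dk` over `k ∈ M` is symmetric in `g` and `h` for every continuous biinvariant `f`
(`IsGelfandPair.integral_mul_mul_comm`). Let `P` be the projection onto the `K(n)`-fixed vectors.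
Applied to the coefficients of the representation on `G(n)`, the symmetry says that
`∑ c h • P (π h v) ↦ ∑ conj (c h) • P (π h⁻¹ v)` is an antiunitary involution. It fixes `S v` for
every self-adjoint intertwiner `S`, whence
`⟪T (π g v), S v⟫ = ⟪S v, T (π g⁻¹ v)⟫`, which is `S T = T S`. Vectors `S v` are only approximated
by combinations of vectors `π h v` with `h ∈ G(n)` for some `n`, but the projection for that `n`
does not increase the error, so no limit of the projections is needed
(`CyclicRep.norm_inner_sub_inner_le`).

For commuting `a` and `b`, the operator `(a + b - |a - b|) / 2` is the infimum of `a` and `b`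
among intertwiners, because `-q ≤ d ≤ q` implies `|d| ≤ q` for commuting `d` and `q`
(`CFC.abs_le_of_commute`). This gives the infimum `m` of `x` and `y` in the cone, taking
`ω = x + y`. The supremum is `x + y - m`: it is compared with another upper bound `t` in the
representation attached to `x + y + t`.
-/

/-! ### Invariant integrals over compact groups -/

section CompactGroup

variable {C E : Type*} [Group C] [TopologicalSpace C] [IsTopologicalGroup C] [CompactSpace C]
  [MeasurableSpace C] [BorelSpace C] [NormedAddCommGroup E] [NormedSpace ℝ E]
  [CompleteSpace E] (μ : Measure C) [IsProbabilityMeasure μ] [μ.IsMulLeftInvariant]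

/-- A left invariant probability measure on a compact group is invariant under inversion: compare
the two iterated integrals of `f (b⁻¹ * a)`. -/
theorem integral_comp_inv_of_compact {f : C → E} (hf : Continuous f) :
    ∫ a, f a⁻¹ ∂μ = ∫ a, f a ∂μ := by
  have h := integral_integral_swap_of_hasCompactSupport (f := fun a b : C => f (b⁻¹ * a))
    (by fun_prop) (HasCompactSupport.of_compactSpace _) (μ := μ) (ν := μ)
  have h₁ : ∀ b : C, ∫ a, f (b⁻¹ * a) ∂μ = ∫ a, f a ∂μ := fun b =>
    integral_mul_left_eq_self f b⁻¹
  have h₂ : ∀ a : C, ∫ b, f (b⁻¹ * a) ∂μ = ∫ b, f b⁻¹ ∂μ := fun a => by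
    rw [← integral_mul_left_eq_self (fun b => f (b⁻¹ * a)) a]
    simp
  simpa [h₁, h₂] using h

theorem integral_mul_right_of_compact {f : C → E} (hf : Continuous f) (c : C) :
    ∫ a, f (a * c) ∂μ = ∫ a, f a ∂μ := by
  rw [← integral_comp_inv_of_compact μ hf, ← integral_mul_left_eq_self (fun a => f a⁻¹) c⁻¹,
    ← integral_comp_inv_of_compact μ (f := fun a => f (a * c)) (by fun_prop)]
  simp

end CompactGroup

/-! ### Averages over the compact subgroup of a Gelfand pair -/

section Average

variable {H : Type*} [Group H] {M : Subgroup H}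

theorem IsBiinvariant.mul_left {f : H → ℂ} (hf : IsBiinvariant M f) {k : H} (hk : k ∈ M) (x : H) :
    f (k * x) = f x := by
  simpa using hf k hk 1 M.one_mem x

theorem IsBiinvariant.mul_right {f : H → ℂ} (hf : IsBiinvariant M f) {k : H} (hk : k ∈ M) (x : H) :
    f (x * k) = f x := by
  simpa using hf 1 M.one_mem k hk x

theorem IsBiinvariant.mul {f g : H → ℂ} (hf : IsBiinvariant M f) (hg : IsBiinvariant M g) :
    IsBiinvariant M fun x => f x * g x := fun k₁ h₁ k₂ h₂ x => by
  simp only [hf k₁ h₁ k₂ h₂ x, hg k₁ h₁ k₂ h₂ x]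

theorem IsBiinvariant.conj {f : H → ℂ} (hf : IsBiinvariant M f) :
    IsBiinvariant M fun x => conj (f x) := fun k₁ h₁ k₂ h₂ x => by
  simp only [hf k₁ h₁ k₂ h₂ x]

variable [TopologicalSpace H] [MeasurableSpace H] [BorelSpace H] [CompactSpace M]

theorem continuous_integral_subgroup {X E : Type*} [TopologicalSpace X] [NormedAddCommGroup E]
    [NormedSpace ℝ E] (μ : Measure M) [IsFiniteMeasure μ] {F : X → M → E}
    (hF : Continuous F.uncurry) : Continuous fun x => ∫ k, F x k ∂μ := by
  rw [← continuousOn_univ]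
  exact continuousOn_integral_of_compact_support (k := Set.univ) isCompact_univ hF.continuousOn
    (by simp)

/-- A biinvariant bump function, obtained by averaging on both sides a bump function that is `1`
on the double coset of the given point. -/
theorem exists_biinvariant_bump [IsTopologicalGroup H] [T2Space H] [LocallyCompactSpace H]
    (μ : Measure M) [IsProbabilityMeasure μ] [μ.IsMulLeftInvariant] (g : H) :
    ∃ χ : H → ℝ, Continuous χ ∧ HasCompactSupport χ ∧ IsBiinvariant M (fun x => (χ x : ℂ)) ∧
      (∀ x, 0 ≤ χ x) ∧ χ g = 1 := by
  have hM : IsCompact (M : Set H) := isCompact_iff_compactSpace.2 inferInstance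
  have hg : IsCompact ((fun p : H × H => p.1 * g * p.2) '' ((M : Set H) ×ˢ (M : Set H))) :=
    (hM.prod hM).image (by fun_prop)
  obtain ⟨ψ, hψ1, -, hψc, hψ⟩ := exists_continuous_one_zero_of_isCompact hg isClosed_empty
    (Set.disjoint_empty _)
  have hc₁ : Continuous fun p : H × M => ∫ k' : M, ψ (p.2 * p.1 * k') ∂μ :=
    continuous_integral_subgroup μ (by fun_prop)
  refine ⟨fun y => ∫ k : M, ∫ k' : M, ψ (k * y * k') ∂μ ∂μ, ?_, ?_, ?_, ?_, ?_⟩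
  · exact continuous_integral_subgroup μ hc₁
  · have hs : IsCompact ((fun p : H × H × H => p.1 * p.2.1 * p.2.2) ''
        ((M : Set H) ×ˢ tsupport ψ ×ˢ (M : Set H))) :=
      (hM.prod (hψc.isCompact.prod hM)).image (by fun_prop)
    refine HasCompactSupport.intro hs fun x hx => ?_
    have h0 : ∀ k k' : M, ψ (k * x * k') = 0 := fun k k' => by
      by_contra h
      refine hx ⟨(k⁻¹, k * x * k', k'⁻¹), ⟨?_, subset_tsupport _ h, ?_⟩, ?_⟩
      · exact M.inv_mem k.2
      · exact M.inv_mem k'.2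
      · simp [mul_assoc]
    simp [h0]
  · intro k₁ h₁ k₂ h₂ x
    have e₁ : ∀ k : M, ∫ k' : M, ψ (k * (k₁ * x * k₂) * k') ∂μ =
        ∫ k' : M, ψ ((k * ⟨k₁, h₁⟩ : M) * x * k') ∂μ := fun k => by
      rw [← integral_mul_left_eq_self (fun k' : M => ψ ((k * ⟨k₁, h₁⟩ : M) * x * k')) ⟨k₂, h₂⟩]
      simp [mul_assoc]
    simp only [e₁]
    rw [integral_mul_right_of_compact μ (f := fun k : M => ∫ k' : M, ψ (k * x * k') ∂μ)
      (hc₁.comp (by fun_prop : Continuous fun k : M => (x, k)))]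
  · exact fun x => integral_nonneg fun k => integral_nonneg fun k' => (hψ _).1
  · have h1 : ∀ k k' : M, ψ (k * g * k') = 1 := fun k k' =>
      hψ1 ⟨(k, k'), ⟨k.2, k'.2⟩, rfl⟩
    simp [h1]

end Average

/-! ### Spherical averages in a Gelfand pair -/

section Gelfand

variable {H : Type*} [Group H] [TopologicalSpace H] [IsTopologicalGroup H]
  [LocallyCompactSpace H] [MeasurableSpace H] [BorelSpace H] {M : Subgroup H}

/-- The pairing of a continuous function with a convolution. -/
theorem integral_mul_haarConvolution {f u w : H → ℂ} (hf : Continuous f) (hu : Continuous u)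
    (hw : Continuous w) (hus : HasCompactSupport u) (hws : HasCompactSupport w) :
    ∫ x, f x * haarConvolution u w x ∂(Measure.haar : Measure H) =
      ∫ y, ∫ z, f (y * z) * (u y * w z) ∂(Measure.haar : Measure H)
        ∂(Measure.haar : Measure H) := by
  have hs : HasCompactSupport (Function.uncurry fun x y : H => f x * (u y * w (y⁻¹ * x))) := by
    refine HasCompactSupport.intro (K := (fun p : H × H => (p.1 * p.2, p.1)) ''
      (tsupport u ×ˢ tsupport w)) ((hus.isCompact.prod hws.isCompact).image (by fun_prop)) ?_
    rintro ⟨x, y⟩ hxy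
    by_contra h
    have h' : u y ≠ 0 ∧ w (y⁻¹ * x) ≠ 0 := by
      constructor <;> intro h0 <;> simp [h0] at h
    exact hxy ⟨(y, y⁻¹ * x), ⟨subset_tsupport _ h'.1, subset_tsupport _ h'.2⟩, by simp⟩
  have hswap := integral_integral_swap_of_hasCompactSupport (by fun_prop) hs
    (μ := (Measure.haar : Measure H)) (ν := (Measure.haar : Measure H))
  simp only [haarConvolution, ← integral_const_mul]
  rw [hswap]
  congr 1 with y
  rw [← integral_mul_left_eq_self (fun x => f x * (u y * w (y⁻¹ * x))) y]
  simp

variable (μ : Measure M) [IsProbabilityMeasure μ]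

/-- Against a left `M`-invariant weight, averaging the kernel `f (y * z)` over `M` has no effect. -/
theorem integral_average_mul [CompactSpace M] {f u w : H → ℂ} (hf : Continuous f)
    (hw : Continuous w) (hws : HasCompactSupport w) (hwM : IsBiinvariant M w) (y : H) :
    ∫ z, (∫ k : M, f (y * k * z) ∂μ) * (u y * w z) ∂(Measure.haar : Measure H) =
      ∫ z, f (y * z) * (u y * w z) ∂(Measure.haar : Measure H) := by
  simp only [← integral_mul_const]
  have hs : HasCompactSupport
      (Function.uncurry fun (z : H) (k : M) => f (y * k * z) * (u y * w z)) := by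
    refine HasCompactSupport.intro (K := tsupport w ×ˢ (Set.univ : Set M))
      (hws.isCompact.prod isCompact_univ) ?_
    rintro ⟨z, k⟩ hz
    have : w z = 0 := by
      by_contra h
      exact hz ⟨subset_tsupport _ h, trivial⟩
    simp [this]
  rw [integral_integral_swap_of_hasCompactSupport (by fun_prop) hs]
  have h : ∀ k : M, ∫ z, f (y * k * z) * (u y * w z) ∂(Measure.haar : Measure H) =
      ∫ z, f (y * z) * (u y * w z) ∂(Measure.haar : Measure H) := fun k => by
    rw [← integral_mul_left_eq_self (fun z => f (y * z) * (u y * w z)) (k : H)]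
    simp [hwM.mul_left k.2, mul_assoc]
  simp [h]

variable [T2Space H]

/-- A continuous biinvariant function orthogonal to all compactly supported continuous biinvariant
functions vanishes. -/
theorem eq_zero_of_integral_mul_eq_zero [CompactSpace M] [μ.IsMulLeftInvariant] {E : H → ℂ}
    (hE : Continuous E) (hEM : IsBiinvariant M E)
    (h : ∀ u : H → ℂ, Continuous u → HasCompactSupport u → IsBiinvariant M u →
      ∫ y, E y * u y ∂(Measure.haar : Measure H) = 0) (g : H) : E g = 0 := by
  obtain ⟨χ, hχ, hχs, hχM, hχ0, hχg⟩ := exists_biinvariant_bump μ g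
  have hs : HasCompactSupport fun x => (χ x : ℂ) * conj (E x) :=
    (hχs.comp_left (g := fun r : ℝ => (r : ℂ)) (by simp)).mul_right
  have h1 : ∫ y, E y * ((χ y : ℂ) * conj (E y)) ∂(Measure.haar : Measure H) = 0 :=
    h _ ((Complex.continuous_ofReal.comp hχ).mul (Complex.continuous_conj.comp hE)) hs
      (hχM.mul hEM.conj)
  have h2 : ∀ y, E y * ((χ y : ℂ) * conj (E y)) = ((χ y * ‖E y‖ ^ 2 : ℝ) : ℂ) := fun y => by
    push_cast
    rw [← Complex.mul_conj']
    ring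
  simp only [h2] at h1
  rw [integral_complex_ofReal, Complex.ofReal_eq_zero] at h1
  have hc : Continuous fun y => χ y * ‖E y‖ ^ 2 := hχ.mul (hE.norm.pow 2)
  have hs' : HasCompactSupport fun y => χ y * ‖E y‖ ^ 2 := hχs.mul_right
  by_contra hne
  refine (Continuous.integral_pos_of_hasCompactSupport_nonneg_nonzero
    (μ := (Measure.haar : Measure H)) hc hs' (fun y => mul_nonneg (hχ0 y) (sq_nonneg _))
    (x := g) ?_).ne' h1
  simpa [hχg] using hne

/-- For a Gelfand pair `(H, M)`, the average over `k ∈ M` of `f (g * k * h)` is symmetric in `g`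
and `h`, for every continuous `M`-biinvariant function `f`. -/
theorem IsGelfandPair.integral_mul_mul_comm (hM : IsGelfandPair M) [μ.IsMulLeftInvariant]
    {f : H → ℂ} (hf : Continuous f) (hfM : IsBiinvariant M f) (g h : H) :
    ∫ k : M, f (g * k * h) ∂μ = ∫ k : M, f (h * k * g) ∂μ := by
  have : CompactSpace M := isCompact_iff_compactSpace.1 hM.isCompact
  let ν : Measure H := Measure.haar
  let A : H → H → ℂ := fun y z => ∫ k : M, f (y * k * z) ∂μ
  have hA : Continuous A.uncurry := continuous_integral_subgroup μ
    (F := fun (p : H × H) (k : M) => f (p.1 * k * p.2)) (by fun_prop)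
  have hA₁ : ∀ z, IsBiinvariant M fun y => A y z := fun z k₁ h₁ k₂ h₂ y => by
    simp only [A]
    rw [← integral_mul_left_eq_self (fun k : M => f (y * k * z)) ⟨k₂, h₂⟩]
    congr 1 with k
    rw [← hfM.mul_left h₁ (y * _ * z)]
    simp [mul_assoc]
  have hA₂ : ∀ y, IsBiinvariant M fun z => A y z := fun y k₁ h₁ k₂ h₂ z => by
    simp only [A]
    rw [← integral_mul_right_of_compact μ (f := fun k : M => f (y * k * z)) (by fun_prop)
      ⟨k₁, h₁⟩]
    congr 1 with k
    rw [← hfM.mul_right h₂ (y * _ * z)]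
    simp [mul_assoc]
  -- The difference of the two sides of the identity to be proved.
  let D : H → H → ℂ := fun y z => A y z - A z y
  have hD : Continuous D.uncurry := hA.sub (hA.comp continuous_swap)
  have hDy : ∀ y, Continuous (D y) := fun y => hD.comp (by fun_prop : Continuous fun z => (y, z))
  have hAs : ∀ {a b : H → ℂ}, Continuous a → Continuous b → HasCompactSupport a →
      HasCompactSupport b → ∀ {B : H → H → ℂ}, Continuous B.uncurry →
      Continuous (Function.uncurry fun y z => B y z * (a y * b z)) ∧
      HasCompactSupport (Function.uncurry fun y z => B y z * (a y * b z)) := by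
    intro a b ha hb has hbs B hB
    refine ⟨hB.mul (by fun_prop), HasCompactSupport.intro (has.isCompact.prod hbs.isCompact) ?_⟩
    rintro ⟨y, z⟩ hyz
    by_contra h0
    have h' : a y ≠ 0 ∧ b z ≠ 0 := by
      constructor <;> intro h0' <;> simp [h0'] at h0
    exact hyz ⟨subset_tsupport _ h'.1, subset_tsupport _ h'.2⟩
  have key : ∀ u w : H → ℂ, Continuous u → Continuous w → HasCompactSupport u →
      HasCompactSupport w → IsBiinvariant M u → IsBiinvariant M w →
      ∫ y, ∫ z, D y z * (u y * w z) ∂ν ∂ν = 0 := by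
    intro u w hu hw hus hws huM hwM
    have h1 : ∀ a b : H → ℂ, Continuous a → Continuous b → HasCompactSupport a →
        HasCompactSupport b → IsBiinvariant M a → IsBiinvariant M b →
        ∫ y, ∫ z, A y z * (a y * b z) ∂ν ∂ν = ∫ x, f x * haarConvolution a b x ∂ν := by
      intro a b ha hb has hbs haM hbM
      rw [integral_mul_haarConvolution hf ha hb has hbs]
      congr 1 with y
      exact integral_average_mul μ hf hb hbs hbM y
    have h2 : ∫ y, ∫ z, A z y * (u y * w z) ∂ν ∂ν = ∫ x, f x * haarConvolution w u x ∂ν := by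
      obtain ⟨hc, hs⟩ := hAs hu hw hus hws (B := fun y z => A z y) (hA.comp continuous_swap)
      rw [integral_integral_swap_of_hasCompactSupport hc hs, ← h1 w u hw hu hws hus hwM huM]
      simp only [mul_comm (u _)]
    have h3 : ∫ x, f x * haarConvolution u w x ∂ν = ∫ x, f x * haarConvolution w u x ∂ν := by
      refine integral_congr_ae ?_
      filter_upwards [hM.convolution_comm u w huM hwM (hu.integrable_of_hasCompactSupport hus)
        (hw.integrable_of_hasCompactSupport hws)] with x hx
      rw [hx]
    have hint : ∀ {B : H → H → ℂ}, Continuous B.uncurry →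
        (∀ y, Integrable (fun z => B y z * (u y * w z)) ν) ∧
        Integrable (fun y => ∫ z, B y z * (u y * w z) ∂ν) ν := by
      intro B hB
      obtain ⟨hc, hs⟩ := hAs hu hw hus hws hB
      refine ⟨fun y => ?_, ?_⟩
      · refine Continuous.integrable_of_hasCompactSupport
          (hc.comp (by fun_prop : Continuous fun z => (y, z))) ?_
        exact (hws.mul_left (f := fun _ => u y)).mul_left
      · refine Continuous.integrable_of_hasCompactSupport ?_ ?_
        · rw [← continuousOn_univ]
          refine continuousOn_integral_of_compact_support hws.isCompact hc.continuousOn ?_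
          intro y z _ hz
          simp [image_eq_zero_of_notMem_tsupport hz]
        · refine HasCompactSupport.intro hus.isCompact fun y hy => ?_
          simp [image_eq_zero_of_notMem_tsupport hy]
    obtain ⟨i1, i2⟩ := hint hA
    obtain ⟨i3, i4⟩ := hint (B := fun y z => A z y) (hA.comp continuous_swap)
    simp only [D, sub_mul]
    rw [integral_congr_ae (Filter.Eventually.of_forall fun y => integral_sub (i1 y) (i3 y)),
      integral_sub i2 i4, h1 u w hu hw hus hws huM hwM, h2, h3, sub_self]
  -- Remove the weights `w` and `u` one after the other.
  have hDg : ∀ y z, D y z = 0 := fun y z => by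
    refine eq_zero_of_integral_mul_eq_zero μ (hDy y) (fun k₁ h₁ k₂ h₂ z => ?_)
      (fun w hw hws hwM => ?_) z
    · simp only [D, hA₂ y k₁ h₁ k₂ h₂ z, hA₁ y k₁ h₁ k₂ h₂ z]
    · refine eq_zero_of_integral_mul_eq_zero μ (E := fun y => ∫ z, D y z * w z ∂ν) ?_ ?_ ?_ y
      · rw [← continuousOn_univ]
        refine continuousOn_integral_of_compact_support hws.isCompact
          (f := fun y z => D y z * w z) (hD.mul (by fun_prop)).continuousOn ?_
        intro y z _ hz
        simp [image_eq_zero_of_notMem_tsupport hz]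
      · intro k₁ h₁ k₂ h₂ y
        simp only [D, hA₁ _ k₁ h₁ k₂ h₂ y, hA₂ _ k₁ h₁ k₂ h₂ y]
      · intro u hu hus huM
        rw [← key u w hu hw hus hws huM hwM]
        congr 1 with y
        rw [← integral_mul_const]
        congr 1 with z
        ring
  exact sub_eq_zero.1 (hDg g h)

end Gelfand

/-! ### Functions of positive type and cyclic unitary representations -/

section PositiveType

variable {G : Type*} [Group G]

theorem IsPositiveType.finsupp_sum_nonneg {φ : G → ℂ} (hφ : IsPositiveType φ) (c : G →₀ ℂ) :
    0 ≤ c.sum fun x a => c.sum fun y b => conj a * b * φ (x⁻¹ * y) := by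
  have h := hφ c.support.card (fun i => c.support.equivFin.symm i)
    (fun i => c (c.support.equivFin.symm i))
  have e : ∀ f : G → ℂ, ∑ i, f (c.support.equivFin.symm i) = ∑ x ∈ c.support, f x := fun f => by
    rw [← c.support.sum_coe_sort]
    exact Fintype.sum_equiv c.support.equivFin.symm _ _ fun _ => rfl
  rw [Finset.sum_comm] at h
  simp only [Finsupp.sum]
  convert h using 1
  rw [← e]
  refine Finset.sum_congr rfl fun i _ => ?_
  rw [← e]
  exact Finset.sum_congr rfl fun j _ => by ring

theorem IsPositiveType.apply_inv {φ : G → ℂ} (hφ : IsPositiveType φ) (x : G) :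
    φ x⁻¹ = conj (φ x) := by
  have h (a : ℂ) := (Complex.le_def.1 (hφ 2 ![1, x] ![1, a])).2
  have h0 := (Complex.le_def.1 (hφ 1 ![1] ![1])).2
  have h1 := h 1
  have h2 := h Complex.I
  simp [Fin.sum_univ_two] at h0 h1 h2
  apply Complex.ext <;> simp <;> linarith

end PositiveType

open scoped InnerProductSpace

universe u

/-- The Kolmogorov decomposition of a function of positive type. -/
theorem IsPositiveType.exists_inner_eq {G : Type u} [Group G] {φ : G → ℂ} (hφ : IsPositiveType φ) :
    ∃ (E : Type u) (_ : NormedAddCommGroup E) (_ : InnerProductSpace ℂ E) (_ : CompleteSpace E)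
      (ξ : G → E), (∀ x y, ⟪ξ x, ξ y⟫_ℂ = φ (x⁻¹ * y)) ∧
        (Submodule.span ℂ (Set.range ξ)).topologicalClosure = ⊤ := by
  let k : Matrix G G (ℂ →L[ℂ] ℂ) := .of fun x y => φ (x⁻¹ * y) • (1 : ℂ →L[ℂ] ℂ)
  have hk : k.PosSemidef := by
    have hiff := (RKHS.posSemidef_tfae (K := k)).out 0 2
    refine hiff.2 ⟨?_, fun c => ?_⟩
    · ext x y
      have := hφ.apply_inv (y⁻¹ * x)
      simp only [mul_inv_rev, inv_inv] at this
      simp [k, this]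
    · have e : (c.sum fun x w => c.sum fun x' w' => ⟪k x' x w, w'⟫_ℂ) =
          conj (c.sum fun x a => c.sum fun y b => conj a * b * φ (x⁻¹ * y)) := by
        rw [Finsupp.sum_comm]
        simp only [map_finsuppSum]
        refine Finsupp.sum_congr fun x _ => Finsupp.sum_congr fun y _ => ?_
        simp [k]
        ring
      rw [e, RCLike.conj_re]
      exact (Complex.le_def.1 (hφ.finsupp_sum_nonneg c)).1
  have : Fact k.PosSemidef := ⟨hk⟩
  refine ⟨RKHS.OfKernel k, inferInstance, inferInstance, inferInstance,
    fun x => RKHS.kerFun (RKHS.OfKernel k) x 1, fun x y => ?_, ?_⟩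
  · rw [← RKHS.kernel_inner, RKHS.OfKernel.kernel_ofKernel]
    have := hφ.apply_inv (y⁻¹ * x)
    simp only [mul_inv_rev, inv_inv] at this
    simp [k, this]
  · rw [eq_top_iff, ← RKHS.kerFun_dense (RKHS.OfKernel k)]
    refine Submodule.topologicalClosure_mono (Submodule.span_le.2 ?_)
    rintro _ ⟨x, a, rfl⟩
    have : RKHS.kerFun (RKHS.OfKernel k) x a = a • RKHS.kerFun (RKHS.OfKernel k) x 1 := by
      rw [← map_smul, smul_eq_mul, mul_one]
    rw [this]
    exact Submodule.smul_mem _ _ (Submodule.subset_span ⟨x, rfl⟩)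

/-- A vector is determined by its inner products with a family with dense span. -/
theorem eq_of_forall_inner_eq {X E : Type*} [NormedAddCommGroup E] [InnerProductSpace ℂ E]
    {ξ : X → E} (hξ : (Submodule.span ℂ (Set.range ξ)).topologicalClosure = ⊤) {a b : E}
    (h : ∀ x, ⟪a, ξ x⟫_ℂ = ⟪b, ξ x⟫_ℂ) : a = b := by
  have : innerSL ℂ a = innerSL ℂ b :=
    ContinuousLinearMap.ext_on ((Submodule.dense_iff_topologicalClosure_eq_top).2 hξ)
      (by rintro _ ⟨x, rfl⟩; exact h x)
  exact ext_inner_right ℂ fun x => DFunLike.congr_fun this x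

/-- A linear map determined by its values on a family with dense span. -/
theorem exists_continuousLinearMap_of_norm_le {X E F : Type*} [NormedAddCommGroup E]
    [InnerProductSpace ℂ E] [NormedAddCommGroup F] [InnerProductSpace ℂ F] [CompleteSpace F]
    {ξ : X → E} {η : X → F} (hξ : (Submodule.span ℂ (Set.range ξ)).topologicalClosure = ⊤)
    (h : ∀ c : X →₀ ℂ, ‖Finsupp.linearCombination ℂ η c‖ ≤ ‖Finsupp.linearCombination ℂ ξ c‖) :
    ∃ A : E →L[ℂ] F, ∀ x, A (ξ x) = η x := by
  have hd : DenseRange (Finsupp.linearCombination ℂ ξ) := by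
    rw [← Submodule.dense_iff_topologicalClosure_eq_top] at hξ
    rwa [← Finsupp.range_linearCombination] at hξ
  refine ⟨(Finsupp.linearCombination ℂ η).extendOfNorm (Finsupp.linearCombination ℂ ξ),
    fun x => ?_⟩
  have := LinearMap.extendOfNorm_eq hd ⟨1, fun c => by simpa using h c⟩ (Finsupp.single x 1)
  simpa using this

theorem inner_linearCombination {X E : Type*} [NormedAddCommGroup E]
    [InnerProductSpace ℂ E] (ξ η : X → E) (c d : X →₀ ℂ) :
    ⟪Finsupp.linearCombination ℂ ξ c, Finsupp.linearCombination ℂ η d⟫_ℂ =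
      c.sum fun x a => d.sum fun y b => conj a * b * ⟪ξ x, η y⟫_ℂ := by
  rw [Finsupp.sum_comm]
  simp only [Finsupp.linearCombination_apply, Finsupp.sum_inner, Finsupp.inner_sum,
    inner_smul_left, inner_smul_right, Finsupp.mul_sum, mul_left_comm, mul_assoc]

/-- A unitary representation with a cyclic vector `v`. -/
structure CyclicRep (G E : Type*) [Group G] [NormedAddCommGroup E] [InnerProductSpace ℂ E] where
  /-- the representation -/
  π : G →* (E →L[ℂ] E)
  /-- the cyclic vector -/
  v : E
  inner_map : ∀ g x y, ⟪π g x, π g y⟫_ℂ = ⟪x, y⟫_ℂ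
  dense : (Submodule.span ℂ (Set.range fun g => π g v)).topologicalClosure = ⊤

/-- The Gelfand–Naimark–Segal construction. -/
theorem IsPositiveType.exists_cyclicRep {G : Type u} [Group G] {φ : G → ℂ}
    (hφ : IsPositiveType φ) :
    ∃ (E : Type u) (_ : NormedAddCommGroup E) (_ : InnerProductSpace ℂ E) (_ : CompleteSpace E)
      (ρ : CyclicRep G E), ∀ g, ⟪ρ.v, ρ.π g ρ.v⟫_ℂ = φ g := by
  obtain ⟨E, _, _, _, ξ, hξ, hd⟩ := hφ.exists_inner_eq
  have hlin : ∀ g (c : G →₀ ℂ), ‖Finsupp.linearCombination ℂ (fun x => ξ (g * x)) c‖ =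
      ‖Finsupp.linearCombination ℂ ξ c‖ := fun g c => by
    rw [@norm_eq_sqrt_re_inner ℂ,
      @norm_eq_sqrt_re_inner ℂ _ _ _ _ (Finsupp.linearCombination ℂ ξ c),
      inner_linearCombination, inner_linearCombination]
    simp [hξ, mul_assoc]
  choose U hU using fun g => exists_continuousLinearMap_of_norm_le hd fun c => (hlin g c).le
  have hext : ∀ A B : E →L[ℂ] E, (∀ x, A (ξ x) = B (ξ x)) → A = B := fun A B h =>
    ContinuousLinearMap.ext_on ((Submodule.dense_iff_topologicalClosure_eq_top).2 hd)
      (by rintro _ ⟨x, rfl⟩; exact h x)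
  have hinner : ∀ g x y, ⟪U g x, U g y⟫_ℂ = ⟪x, y⟫_ℂ := fun g => by
    have h1 : (U g).adjoint ∘L (U g) = ContinuousLinearMap.id ℂ E := by
      refine hext _ _ fun x => ?_
      refine eq_of_forall_inner_eq hd fun y => ?_
      simp [ContinuousLinearMap.adjoint_inner_left, hU, hξ, mul_assoc]
    intro x y
    rw [← ContinuousLinearMap.adjoint_inner_right]
    simpa using congrArg (fun A : E →L[ℂ] E => ⟪x, A y⟫_ℂ) h1
  refine ⟨E, inferInstance, inferInstance, inferInstance,
    { π := { toFun := U, map_one' := ?_, map_mul' := ?_ }, v := ξ 1, inner_map := hinner,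
      dense := ?_ }, fun g => ?_⟩
  · exact hext _ _ fun x => by simp [hU]
  · exact fun g h => hext _ _ fun x => by simp [hU, mul_assoc]
  · simpa [hU] using hd
  · simp [hU, hξ]

namespace CyclicRep

variable {G E : Type*} [Group G] [NormedAddCommGroup E] [InnerProductSpace ℂ E]
  (ρ : CyclicRep G E)

/-- `R` commutes with the representation. -/
def IsIntertwiner (R : E →L[ℂ] E) : Prop :=
  ∀ g x, R (ρ.π g x) = ρ.π g (R x)

/-- The coefficient `g ↦ ⟪v, R (π g v)⟫` of the cyclic vector defined by an operator `R`. -/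
noncomputable def coeff (R : E →L[ℂ] E) (g : G) : ℂ :=
  ⟪ρ.v, R (ρ.π g ρ.v)⟫_ℂ

variable {ρ}

theorem π_mul_apply (g h : G) (x : E) : ρ.π (g * h) x = ρ.π g (ρ.π h x) := by
  rw [map_mul]
  rfl

theorem inner_π_left (g : G) (x y : E) : ⟪ρ.π g x, y⟫_ℂ = ⟪x, ρ.π g⁻¹ y⟫_ℂ := by
  rw [← ρ.inner_map g x, ← π_mul_apply]
  simp

theorem norm_π (g : G) (x : E) : ‖ρ.π g x‖ = ‖x‖ := by
  rw [@norm_eq_sqrt_re_inner ℂ, ρ.inner_map, ← norm_eq_sqrt_re_inner]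

theorem coeff_sub (R S : E →L[ℂ] E) : ρ.coeff (R - S) = ρ.coeff R - ρ.coeff S := by
  ext g
  simp [coeff]

theorem coeff_add (R S : E →L[ℂ] E) : ρ.coeff (R + S) = ρ.coeff R + ρ.coeff S := by
  ext g
  simp [coeff]

namespace IsIntertwiner

variable {R S : E →L[ℂ] E}

theorem add (hR : ρ.IsIntertwiner R) (hS : ρ.IsIntertwiner S) : ρ.IsIntertwiner (R + S) :=
  fun g x => by simp [hR g x, hS g x]

theorem sub (hR : ρ.IsIntertwiner R) (hS : ρ.IsIntertwiner S) : ρ.IsIntertwiner (R - S) :=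
  fun g x => by simp [hR g x, hS g x]

theorem inner_eq_coeff (hR : ρ.IsIntertwiner R) (x y : G) :
    ⟪ρ.π x ρ.v, R (ρ.π y ρ.v)⟫_ℂ = ρ.coeff R (x⁻¹ * y) := by
  rw [inner_π_left, ← hR, ← π_mul_apply, coeff]

/-- The correspondence between intertwiners and coefficients respects positivity. -/
theorem isPositiveType_coeff_iff [CompleteSpace E] (hR : ρ.IsIntertwiner R) :
    IsPositiveType (ρ.coeff R) ↔ 0 ≤ R := by
  have hpos : 0 ≤ R ↔ ∀ x, 0 ≤ ⟪x, R x⟫_ℂ := by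
    rw [ContinuousLinearMap.nonneg_iff_isPositive, ContinuousLinearMap.isPositive_iff_complex]
    refine forall_congr' fun x => ?_
    have h1 : (⟪R x, x⟫_ℂ).re = (⟪x, R x⟫_ℂ).re := inner_re_symm (𝕜 := ℂ) _ _
    have h2 : (⟪R x, x⟫_ℂ).im = -(⟪x, R x⟫_ℂ).im := inner_im_symm (𝕜 := ℂ) _ _
    rw [Complex.nonneg_iff, Complex.ext_iff]
    simp [h1, h2, and_comm, eq_comm (a := (0 : ℝ))]
  rw [hpos]
  constructor
  · intro h x
    have hcl : IsClosed {x : E | 0 ≤ ⟪x, R x⟫_ℂ} :=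
      isClosed_le continuous_const (by fun_prop)
    have hd := (Submodule.dense_iff_topologicalClosure_eq_top).2 ρ.dense
    refine hd.induction (P := fun x => 0 ≤ ⟪x, R x⟫_ℂ) (fun y hy => ?_) hcl x
    obtain ⟨c, rfl⟩ := (Finsupp.mem_span_range_iff_exists_finsupp).1 hy
    have e : R (c.sum fun g a => a • ρ.π g ρ.v) =
        Finsupp.linearCombination ℂ (fun g => R (ρ.π g ρ.v)) c := by
      simp [Finsupp.linearCombination_apply, map_finsuppSum]
    change 0 ≤ ⟪Finsupp.linearCombination ℂ (fun g => ρ.π g ρ.v) c, R _⟫_ℂ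
    rw [e, inner_linearCombination]
    simpa only [hR.inner_eq_coeff] using h.finsupp_sum_nonneg c
  · intro h n g c
    convert h (∑ i, c i • ρ.π (g i) ρ.v) using 1
    simp only [map_sum, map_smul, sum_inner, inner_sum, inner_smul_left, inner_smul_right,
      hR.inner_eq_coeff, Finset.mul_sum]
    refine Finset.sum_congr rfl fun i _ => Finset.sum_congr rfl fun j _ => ?_
    ring

end IsIntertwiner

/-- The Radon–Nikodym theorem for functions of positive type: a function of positive type dominated
by the coefficient of the cyclic vector is the coefficient of a positive intertwiner. If `A` is the
contraction to the Hilbert space of `ψ` that maps one cyclic vector to the other, the intertwiner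
is `A† A`. -/
theorem exists_coeff_eq {G : Type u} {E : Type*} [Group G] [NormedAddCommGroup E]
    [InnerProductSpace ℂ E] [CompleteSpace E] (ρ : CyclicRep G E) {ψ : G → ℂ}
    (hψ : IsPositiveType ψ) (hle : IsPositiveType (ρ.coeff 1 - ψ)) :
    ∃ R : E →L[ℂ] E, ρ.IsIntertwiner R ∧ 0 ≤ R ∧ ρ.coeff R = ψ := by
  obtain ⟨F, _, _, _, η, hη, -⟩ := hψ.exists_inner_eq
  have h1 : ρ.IsIntertwiner 1 := fun g x => rfl
  obtain ⟨A, hA⟩ := exists_continuousLinearMap_of_norm_le (η := η) ρ.dense fun c => by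
    have h := hle.finsupp_sum_nonneg c
    rw [@norm_eq_sqrt_re_inner ℂ, @norm_eq_sqrt_re_inner ℂ E, inner_linearCombination,
      inner_linearCombination]
    refine Real.sqrt_le_sqrt ?_
    have h2 := (Complex.le_def.1 h).1
    have e1 : ∀ x y, ⟪ρ.π x ρ.v, ρ.π y ρ.v⟫_ℂ = ρ.coeff 1 (x⁻¹ * y) := h1.inner_eq_coeff
    simp only [hη, e1]
    simp only [Pi.sub_apply, mul_sub, Finsupp.sum_sub, Complex.sub_re, Complex.zero_re,
      sub_nonneg] at h2
    exact h2
  have hR : ∀ x y, ⟪ρ.π x ρ.v, (A.adjoint ∘L A) (ρ.π y ρ.v)⟫_ℂ = ψ (x⁻¹ * y) := fun x y => by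
    simp [ContinuousLinearMap.adjoint_inner_right, hA, hη]
  have hI : ρ.IsIntertwiner (A.adjoint ∘L A) := fun g => by
    have : (A.adjoint ∘L A) ∘L ρ.π g = ρ.π g ∘L (A.adjoint ∘L A) := by
      refine ContinuousLinearMap.ext_on ((Submodule.dense_iff_topologicalClosure_eq_top).2 ρ.dense)
        ?_
      rintro _ ⟨y, rfl⟩
      refine eq_of_forall_inner_eq ρ.dense fun x => ?_
      rw [← inner_conj_symm, ← inner_conj_symm (_ : E) (ρ.π x ρ.v)]
      congr 1
      rw [ContinuousLinearMap.comp_apply, ← π_mul_apply, hR, ContinuousLinearMap.comp_apply,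
        ← inv_inv g, ← inner_π_left, ← π_mul_apply, hR]
      simp [mul_assoc]
    exact fun x => DFunLike.congr_fun this x
  have hc : ρ.coeff (A.adjoint ∘L A) = ψ := by
    ext g
    simpa [coeff] using hR 1 g
  exact ⟨_, hI, hI.isPositiveType_coeff_iff.1 (hc ▸ hψ), hc⟩

end CyclicRep

/-! ### Commutativity of the algebra of intertwiners -/

namespace CyclicRep

variable {G E : Type*} [Group G] [NormedAddCommGroup E] [InnerProductSpace ℂ E]

/-- An orthogonal projection which fixes the cyclic vector, lies in the bicommutant of the
representation, and for which the operators `P (π g) P`, `g ∈ F`, commute in the weak sense `flip`.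
For a group with a Gelfand pair, this is the projection onto the vectors fixed by the compact
subgroup. -/
structure IsFlipProjection (ρ : CyclicRep G E) (F : Set G) (P : E →L[ℂ] E) : Prop where
  norm_le : ∀ x, ‖P x‖ ≤ ‖x‖
  inner_left : ∀ x y, ⟪P x, y⟫_ℂ = ⟪x, P y⟫_ℂ
  idem : ∀ x, P (P x) = P x
  map_v : P ρ.v = ρ.v
  commute : ∀ R, ρ.IsIntertwiner R → ∀ x, P (R x) = R (P x)
  flip : ∀ R, ρ.IsIntertwiner R → ∀ g ∈ F, ∀ h ∈ F,
    ⟪P (ρ.π g ρ.v), R (ρ.π h ρ.v)⟫_ℂ = ⟪P (ρ.π h⁻¹ ρ.v), R (ρ.π g⁻¹ ρ.v)⟫_ℂ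

variable {ρ : CyclicRep G E}

/-- If a combination `x = ∑ c h • π h v` approximates `S v`, then so does `P x`, and so does, with
the same error, its flip `∑ conj (c h) • P (π h⁻¹ v)`. Passing from one to the other exchanges `S`
and `T` in the coefficient of `v`. -/
theorem norm_inner_sub_inner_le {F : Set G} {P S T : E →L[ℂ] E} (hP : ρ.IsFlipProjection F P)
    (hS : ρ.IsIntertwiner S) (hT : ρ.IsIntertwiner T) (hSs : ∀ x y, ⟪S x, y⟫_ℂ = ⟪x, S y⟫_ℂ)
    (hTs : ∀ x y, ⟪T x, y⟫_ℂ = ⟪x, T y⟫_ℂ) {g : G} (hg : g ∈ F) {s : Finset G}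
    (hs : (s : Set G) ⊆ F) (c : G → ℂ) :
    ‖⟪T (ρ.π g ρ.v), S ρ.v⟫_ℂ - ⟪S ρ.v, T (ρ.π g⁻¹ ρ.v)⟫_ℂ‖ ≤
      (‖T (ρ.π g ρ.v)‖ + ‖T (ρ.π g⁻¹ ρ.v)‖) * ‖∑ h ∈ s, c h • ρ.π h ρ.v - S ρ.v‖ := by
  set x := ∑ h ∈ s, c h • ρ.π h ρ.v with hx
  set x' := ∑ h ∈ s, conj (c h) • ρ.π h⁻¹ ρ.v with hx'
  have h1 : ρ.IsIntertwiner 1 := fun g x => rfl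
  have hPS : P (S ρ.v) = S ρ.v := by rw [hP.commute S hS, hP.map_v]
  have hPP : ∀ y z, ⟪P y, P z⟫_ℂ = ⟪P y, z⟫_ℂ := fun y z => by rw [← hP.inner_left, hP.idem]
  have e₁ : ⟪P x', P x'⟫_ℂ = ⟪P x, P x⟫_ℂ := by
    rw [hPP, hPP, hx, hx']
    simp only [map_sum, map_smul, sum_inner, inner_sum, inner_smul_left, inner_smul_right,
      Complex.conj_conj, Finset.mul_sum]
    rw [Finset.sum_comm]
    refine Finset.sum_congr rfl fun i hi => Finset.sum_congr rfl fun j hj => ?_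
    have := hP.flip 1 h1 j (hs hj) i (hs hi)
    simp only [one_apply_eq_self] at this
    rw [this]
    ring
  have e₂ : ⟪P x', S ρ.v⟫_ℂ = ⟪S ρ.v, P x⟫_ℂ := by
    rw [hP.inner_left, ← hP.inner_left, hP.inner_left, hPS, ← hP.inner_left, hPS, hx, hx']
    simp only [sum_inner, inner_sum, inner_smul_left, inner_smul_right, Complex.conj_conj]
    refine Finset.sum_congr rfl fun i _ => ?_
    rw [inner_π_left, inv_inv, ← hS, hSs]
  have e₃ : ⟪S ρ.v, P x'⟫_ℂ = ⟪P x, S ρ.v⟫_ℂ := by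
    rw [← inner_conj_symm, e₂, inner_conj_symm]
  have hn : ‖P x' - S ρ.v‖ = ‖P x - S ρ.v‖ := by
    rw [@norm_eq_sqrt_re_inner ℂ, @norm_eq_sqrt_re_inner ℂ _ _ _ _ (P x - S ρ.v)]
    simp only [inner_sub_left, inner_sub_right, e₁, e₂, e₃]
    congr 2
    ring
  have hle : ‖P x - S ρ.v‖ ≤ ‖x - S ρ.v‖ := by
    have := hP.norm_le (x - S ρ.v)
    rwa [map_sub, hPS] at this
  have e₄ : ⟪T (ρ.π g ρ.v), P x⟫_ℂ = ⟪P x', T (ρ.π g⁻¹ ρ.v)⟫_ℂ := by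
    rw [hx, hx']
    simp only [map_sum, map_smul, sum_inner, inner_sum, inner_smul_left, inner_smul_right,
      Complex.conj_conj]
    refine Finset.sum_congr rfl fun i hi => ?_
    rw [← hP.inner_left, hP.commute T hT, hTs, hP.flip T hT g hg i (hs hi)]
  calc ‖⟪T (ρ.π g ρ.v), S ρ.v⟫_ℂ - ⟪S ρ.v, T (ρ.π g⁻¹ ρ.v)⟫_ℂ‖
      = ‖⟪P x' - S ρ.v, T (ρ.π g⁻¹ ρ.v)⟫_ℂ - ⟪T (ρ.π g ρ.v), P x - S ρ.v⟫_ℂ‖ := by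
        rw [inner_sub_left, inner_sub_right, e₄]
        congr 1
        ring
    _ ≤ ‖⟪P x' - S ρ.v, T (ρ.π g⁻¹ ρ.v)⟫_ℂ‖ + ‖⟪T (ρ.π g ρ.v), P x - S ρ.v⟫_ℂ‖ :=
        norm_sub_le _ _
    _ ≤ ‖P x' - S ρ.v‖ * ‖T (ρ.π g⁻¹ ρ.v)‖ + ‖T (ρ.π g ρ.v)‖ * ‖P x - S ρ.v‖ :=
        add_le_add (norm_inner_le_norm _ _) (norm_inner_le_norm _ _)
    _ = (‖T (ρ.π g ρ.v)‖ + ‖T (ρ.π g⁻¹ ρ.v)‖) * ‖P x - S ρ.v‖ := by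
        rw [hn]
        ring
    _ ≤ _ := by gcongr

/-- Self-adjoint intertwiners commute if every finite subset of the group admits a flip
projection. -/
theorem commute_of_isFlipProjection (hF : ∀ F : Set G, F.Finite → ∃ P, ρ.IsFlipProjection F P)
    {S T : E →L[ℂ] E} (hS : ρ.IsIntertwiner S) (hT : ρ.IsIntertwiner T)
    (hSs : ∀ x y, ⟪S x, y⟫_ℂ = ⟪x, S y⟫_ℂ) (hTs : ∀ x y, ⟪T x, y⟫_ℂ = ⟪x, T y⟫_ℂ) :
    Commute S T := by
  have hd := (Submodule.dense_iff_topologicalClosure_eq_top).2 ρ.dense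
  have key : ∀ g, ⟪T (ρ.π g ρ.v), S ρ.v⟫_ℂ = ⟪S ρ.v, T (ρ.π g⁻¹ ρ.v)⟫_ℂ := by
    intro g
    refine eq_of_forall_dist_le fun ε hε => ?_
    set C := ‖T (ρ.π g ρ.v)‖ + ‖T (ρ.π g⁻¹ ρ.v)‖ with hC
    have hC0 : 0 ≤ C := by positivity
    obtain ⟨y, hy, hyd⟩ := Metric.mem_closure_iff.1 (hd (S ρ.v)) (ε / (C + 1)) (by positivity)
    obtain ⟨c, rfl⟩ := (Finsupp.mem_span_range_iff_exists_finsupp).1 hy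
    obtain ⟨P, hP⟩ := hF (insert g (c.support : Set G)) (c.support.finite_toSet.insert g)
    have h := norm_inner_sub_inner_le hP hS hT hSs hTs (Set.mem_insert _ _)
      (Set.subset_insert _ _) c
    rw [dist_comm, dist_eq_norm] at hyd
    rw [dist_eq_norm]
    calc _ ≤ C * _ := h
      _ ≤ C * (ε / (C + 1)) := mul_le_mul_of_nonneg_left hyd.le hC0
      _ ≤ ε := by
        rw [mul_div_assoc', div_le_iff₀ (by positivity)]
        nlinarith
  have hv : S (T ρ.v) = T (S ρ.v) := by
    refine eq_of_forall_inner_eq ρ.dense fun g => ?_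
    have h := key g⁻¹
    rw [hT, inner_π_left, inv_inv, ← hS] at h
    rw [hSs, hTs (S ρ.v), h]
  refine ContinuousLinearMap.ext_on hd ?_
  rintro _ ⟨g, rfl⟩
  change S (T _) = T (S _)
  rw [hT, hS, hS, hT, hv]

end CyclicRep

/-! ### Projections onto the vectors fixed by a compact group -/

namespace CyclicRep

section Average

variable {G E C : Type*} [Group G] [NormedAddCommGroup E] [InnerProductSpace ℂ E]
  [Group C] [TopologicalSpace C] [CompactSpace C] [MeasurableSpace C] [BorelSpace C]
  (ρ : CyclicRep G E) {θ : C →* G} (μ : Measure C) [IsProbabilityMeasure μ]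

theorem integrable_π (hθ : ∀ x, Continuous fun k => ρ.π (θ k) x) (x : E) :
    Integrable (fun k => ρ.π (θ k) x) μ :=
  (hθ x).integrable_of_hasCompactSupport (HasCompactSupport.of_compactSpace _)

variable (hθ : ∀ x, Continuous fun k => ρ.π (θ k) x)

/-- The average of a strongly continuous unitary representation over a compact group. -/
noncomputable def average : E →L[ℂ] E :=
  LinearMap.mkContinuous
    { toFun := fun x => ∫ k, ρ.π (θ k) x ∂μ
      map_add' := fun x y => by
        simp only [map_add]
        exact integral_add (ρ.integrable_π μ hθ x) (ρ.integrable_π μ hθ y)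
      map_smul' := fun c x => by
        simp only [map_smul, integral_smul, RingHom.id_apply] } 1 fun x => by
    simpa using norm_integral_le_of_norm_le_const (μ := μ) (f := fun k => ρ.π (θ k) x)
      (Filter.Eventually.of_forall fun k => (norm_π _ x).le)

variable {ρ μ}

theorem average_apply (x : E) : ρ.average μ hθ x = ∫ k, ρ.π (θ k) x ∂μ :=
  rfl

theorem norm_average_le (x : E) : ‖ρ.average μ hθ x‖ ≤ ‖x‖ := by
  simpa using (ρ.average μ hθ).le_of_opNorm_le (LinearMap.mkContinuous_norm_le _ zero_le_one _) x

variable [CompleteSpace E]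

theorem inner_average (x y : E) :
    ⟪x, ρ.average μ hθ y⟫_ℂ = ∫ k, ⟪x, ρ.π (θ k) y⟫_ℂ ∂μ :=
  (integral_inner (ρ.integrable_π μ hθ y) x).symm

theorem average_eq_self {x : E} (hx : ∀ k, ρ.π (θ k) x = x) : ρ.average μ hθ x = x := by
  simp [average_apply, hx]

theorem average_commute {R : E →L[ℂ] E} (hR : ρ.IsIntertwiner R) (x : E) :
    ρ.average μ hθ (R x) = R (ρ.average μ hθ x) := by
  simp only [average_apply, ← hR (θ _)]
  exact R.integral_comp_comm (ρ.integrable_π μ hθ x)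

variable [μ.IsMulLeftInvariant] [IsTopologicalGroup C]

theorem π_average (k : C) (x : E) : ρ.π (θ k) (ρ.average μ hθ x) = ρ.average μ hθ x := by
  rw [average_apply, ← (ρ.π (θ k)).integral_comp_comm (ρ.integrable_π μ hθ x),
    ← integral_mul_left_eq_self (fun k => ρ.π (θ k) x) k]
  simp

theorem inner_average_left (x y : E) :
    ⟪ρ.average μ hθ x, y⟫_ℂ = ⟪x, ρ.average μ hθ y⟫_ℂ := by
  rw [← inner_conj_symm, inner_average, inner_average, ← integral_conj,
    ← integral_comp_inv_of_compact μ (f := fun k => ⟪x, ρ.π (θ k) y⟫_ℂ)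
      (continuous_const.inner (hθ y))]
  simp [inner_conj_symm, inner_π_left]

end Average

/-! ### Representations with a `K`-fixed cyclic vector -/

section Fixed

variable {G E : Type*} [Group G] [NormedAddCommGroup E] [InnerProductSpace ℂ E]
  {ρ : CyclicRep G E} {K : Subgroup G}

theorem isIntertwiner_one : ρ.IsIntertwiner 1 := fun _ _ => rfl

theorem π_v_eq_of_isBiinvariant (h : IsBiinvariant K (ρ.coeff 1)) {k : G} (hk : k ∈ K) :
    ρ.π k ρ.v = ρ.v := by
  refine eq_of_forall_inner_eq ρ.dense fun g => ?_
  have h1 : ∀ x y, ⟪ρ.π x ρ.v, ρ.π y ρ.v⟫_ℂ = ρ.coeff 1 (x⁻¹ * y) :=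
    isIntertwiner_one.inner_eq_coeff
  rw [h1, h.mul_left (K.inv_mem hk)]
  rfl

theorem isBiinvariant_coeff (h : ∀ k ∈ K, ρ.π k ρ.v = ρ.v) {R : E →L[ℂ] E}
    (hR : ρ.IsIntertwiner R) : IsBiinvariant K (ρ.coeff R) := fun k₁ h₁ k₂ h₂ g => by
  rw [coeff, π_mul_apply, h k₂ h₂, π_mul_apply, hR, ← inv_inv k₁, ← inner_π_left,
    h _ (K.inv_mem h₁), coeff]

end Fixed

end CyclicRep

/-! ### Inductive limits -/

namespace IsOlshanskiSphericalPair

variable {H : ℕ → Type*} [∀ n, Group (H n)] [∀ n, TopologicalSpace (H n)]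
  [∀ n, IsTopologicalGroup (H n)] [∀ n, LocallyCompactSpace (H n)]
  [∀ n, MeasurableSpace (H n)] [∀ n, BorelSpace (H n)]
  {L : ∀ n, Subgroup (H n)} {ι : ∀ n, H n →* H (n + 1)}
  {G : Type*} [Group G] [TopologicalSpace G] {j : ∀ n, H n →* G} {K : Subgroup G}

theorem continuous_iff (hGK : IsOlshanskiSphericalPair L ι j K) {X : Type*} [TopologicalSpace X]
    {f : G → X} : Continuous f ↔ ∀ n, Continuous fun y => f (j n y) := by
  simp only [continuous_def, hGK.isOpen_iff]
  exact ⟨fun h n s hs => h s hs n, fun h s hs n => h n s hs⟩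

theorem exists_transition (hGK : IsOlshanskiSphericalPair L ι j K) {n m : ℕ} (h : n ≤ m) :
    ∃ τ : H n → H m, Continuous τ ∧ ∀ y, j m (τ y) = j n y := by
  induction m, h using Nat.le_induction with
  | base => exact ⟨id, continuous_id, fun _ => rfl⟩
  | succ m _ ih =>
    obtain ⟨τ, hτ, hj⟩ := ih
    refine ⟨fun y => ι m (τ y), (hGK.isClosedEmbedding m).continuous.comp hτ, fun y => ?_⟩
    rw [← hj, ← hGK.compatible m]
    rfl

theorem exists_subset_range (hGK : IsOlshanskiSphericalPair L ι j K) {F : Set G} (hF : F.Finite)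
    (n : ℕ) : ∃ m, n ≤ m ∧ F ⊆ Set.range (j m) := by
  induction F, hF using Set.Finite.induction_on with
  | empty => exact ⟨n, le_rfl, Set.empty_subset _⟩
  | @insert a s _ _ ih =>
    obtain ⟨m, hm, hs⟩ := ih
    obtain ⟨k, y, rfl⟩ := hGK.exists_eq a
    obtain ⟨τ, -, hτ⟩ := hGK.exists_transition (le_max_left m k)
    obtain ⟨σ, -, hσ⟩ := hGK.exists_transition (le_max_right m k)
    refine ⟨max m k, hm.trans (le_max_left _ _), Set.insert_subset ⟨σ y, hσ y⟩ fun x hx => ?_⟩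
    obtain ⟨z, rfl⟩ := hs hx
    exact ⟨τ z, hτ z⟩

/-- Translations of `G` are continuous along each `H n`, although `G` need not be a topological
group. -/
theorem continuous_comp_mul_mul (hGK : IsOlshanskiSphericalPair L ι j K) {X : Type*}
    [TopologicalSpace X] {f : G → X} (hf : Continuous f) (a b : G) (n : ℕ) :
    Continuous fun y : H n => f (a * j n y * b) := by
  obtain ⟨m, hnm, hs⟩ := hGK.exists_subset_range (F := {a, b}) (by simp) n
  obtain ⟨a, rfl⟩ := hs (Set.mem_insert _ _)
  obtain ⟨b, rfl⟩ := hs (Set.mem_insert_of_mem _ rfl)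
  obtain ⟨τ, hτ, hj⟩ := hGK.exists_transition hnm
  have h := (hGK.continuous_iff.1 hf m).comp (by fun_prop : Continuous fun y => a * τ y * b)
  refine h.congr fun y => ?_
  simp [hj]

variable {E : Type*} [NormedAddCommGroup E] [InnerProductSpace ℂ E] {ρ : CyclicRep G E}

/-- The representation is strongly continuous on each `H n`. -/
theorem continuous_π (hGK : IsOlshanskiSphericalPair L ι j K) (hc : Continuous (ρ.coeff 1))
    (n : ℕ) (x : E) : Continuous fun y : H n => ρ.π (j n y) x := by
  have hv : ∀ g, Continuous fun y : H n => ρ.π (j n y) (ρ.π g ρ.v) := fun g => by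
    have h1 : ∀ x y, ⟪ρ.π x ρ.v, ρ.π y ρ.v⟫_ℂ = ρ.coeff 1 (x⁻¹ * y) :=
      CyclicRep.isIntertwiner_one.inner_eq_coeff
    rw [continuous_iff_continuousAt]
    intro y₀
    rw [ContinuousAt, tendsto_iff_norm_sub_tendsto_zero]
    have hn : ∀ y : H n, ‖ρ.π (j n y) (ρ.π g ρ.v) - ρ.π (j n y₀) (ρ.π g ρ.v)‖ =
        Real.sqrt (ρ.coeff 1 1 - ρ.coeff 1 (g⁻¹ * j n (y₀⁻¹ * y) * g) -
          (ρ.coeff 1 (g⁻¹ * j n (y⁻¹ * y₀) * g) - ρ.coeff 1 1)).re := fun y => by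
      rw [@norm_eq_sqrt_re_inner ℂ]
      simp only [← CyclicRep.π_mul_apply, inner_sub_left, inner_sub_right, h1]
      simp [mul_assoc]
    simp only [hn]
    have hc' := hGK.continuous_comp_mul_mul hc g⁻¹ g n
    have hcont : Continuous fun y : H n =>
        Real.sqrt (ρ.coeff 1 1 - ρ.coeff 1 (g⁻¹ * j n (y₀⁻¹ * y) * g) -
          (ρ.coeff 1 (g⁻¹ * j n (y⁻¹ * y₀) * g) - ρ.coeff 1 1)).re := by
      have c₁ := hc'.comp (by fun_prop : Continuous fun y : H n => y⁻¹ * y₀)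
      have c₂ := hc'.comp (by fun_prop : Continuous fun y : H n => y₀⁻¹ * y)
      exact Real.continuous_sqrt.comp (Complex.continuous_re.comp
        ((continuous_const.sub c₂).sub (c₁.sub continuous_const)))
    simpa using hcont.tendsto y₀
  have hspan : ∀ z ∈ Submodule.span ℂ (Set.range fun g => ρ.π g ρ.v),
      Continuous fun y : H n => ρ.π (j n y) z := fun z hz => by
    induction hz using Submodule.span_induction with
    | mem z hz => obtain ⟨g, rfl⟩ := hz; exact hv g
    | zero => simpa using continuous_const
    | add a b _ _ ha hb => simpa only [map_add] using! ha.add hb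
    | smul c a _ ha => simpa only [map_smul] using! ha.const_smul c
  refine continuous_of_uniform_approx_of_continuous fun u hu => ?_
  obtain ⟨ε, hε, hu⟩ := Metric.mem_uniformity_dist.1 hu
  obtain ⟨z, hz, hxz⟩ := Metric.mem_closure_iff.1
    ((Submodule.dense_iff_topologicalClosure_eq_top).2 ρ.dense x) ε hε
  refine ⟨fun y => ρ.π (j n y) z, hspan z hz, fun y => hu ?_⟩
  rwa [dist_eq_norm, ← map_sub, CyclicRep.norm_π, ← dist_eq_norm]

theorem continuous_coeff [CompleteSpace E] (hGK : IsOlshanskiSphericalPair L ι j K)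
    (hc : Continuous (ρ.coeff 1)) (R : E →L[ℂ] E) : Continuous (ρ.coeff R) :=
  hGK.continuous_iff.2 fun n =>
    continuous_const.inner (R.continuous.comp (hGK.continuous_π hc n ρ.v))

/-- For a finite subset of `H n`, averaging over `L n` is a flip projection, by the symmetry of
spherical averages in a Gelfand pair. -/
theorem exists_isFlipProjection [∀ n, T2Space (H n)] [CompleteSpace E]
    (hGK : IsOlshanskiSphericalPair L ι j K) (hc : Continuous (ρ.coeff 1))
    (hK : IsBiinvariant K (ρ.coeff 1)) {F : Set G} (hF : F.Finite) :
    ∃ P, ρ.IsFlipProjection F P := by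
  obtain ⟨n, -, hFn⟩ := hGK.exists_subset_range hF 0
  have : CompactSpace (L n) := isCompact_iff_compactSpace.1 (hGK.isGelfandPair n).isCompact
  let μ : Measure (L n) := Measure.haarMeasure ⊤
  have : IsProbabilityMeasure μ := ⟨by
    simpa using Measure.haarMeasure_self (K₀ := (⊤ : TopologicalSpace.PositiveCompacts (L n)))⟩
  let θ : L n →* G := (j n).comp (L n).subtype
  have hθ : ∀ x, Continuous fun k => ρ.π (θ k) x := fun x =>
    (hGK.continuous_π hc n x).comp continuous_subtype_val
  have hv : ∀ k ∈ K, ρ.π k ρ.v = ρ.v := fun k hk => CyclicRep.π_v_eq_of_isBiinvariant hK hk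
  have hjK : ∀ k : H n, k ∈ L n → j n k ∈ K := fun k hk => (hGK.mem_iff _).2 ⟨n, k, hk, rfl⟩
  refine ⟨ρ.average μ hθ, ⟨CyclicRep.norm_average_le hθ, CyclicRep.inner_average_left hθ,
    fun x => CyclicRep.average_eq_self hθ fun k => CyclicRep.π_average hθ k x,
    CyclicRep.average_eq_self hθ fun k => hv _ (hjK k k.2),
    fun R hR => CyclicRep.average_commute hθ hR, fun R hR g hg h hh => ?_⟩⟩
  obtain ⟨g, rfl⟩ := hFn hg
  obtain ⟨h, rfl⟩ := hFn hh
  have e : ∀ a b : H n, ⟪ρ.average μ hθ (ρ.π (j n a) ρ.v), R (ρ.π (j n b) ρ.v)⟫_ℂ =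
      ∫ k : L n, ρ.coeff R (j n (a⁻¹ * k * b)) ∂μ := fun a b => by
    rw [CyclicRep.inner_average_left, CyclicRep.inner_average]
    congr 1 with k
    rw [← hR, ← CyclicRep.π_mul_apply, hR.inner_eq_coeff]
    simp [θ, mul_assoc]
  have hb := CyclicRep.isBiinvariant_coeff hv hR
  have hsymm := (hGK.isGelfandPair n).integral_mul_mul_comm μ
    (f := fun y => ρ.coeff R (j n y)) (hGK.continuous_iff.1 (hGK.continuous_coeff hc R) n)
    (fun k₁ h₁ k₂ h₂ y => by
      simpa using hb _ (hjK k₁ h₁) _ (hjK k₂ h₂) (j n y)) g⁻¹ h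
  rw [← map_inv, ← map_inv, e, e, hsymm]
  simp

/-- Self-adjoint intertwiners of a spherical representation commute. -/
theorem commute_of_isIntertwiner [∀ n, T2Space (H n)] [CompleteSpace E]
    (hGK : IsOlshanskiSphericalPair L ι j K) (hρ : ρ.coeff 1 ∈ positiveTypeCone K)
    {S T : E →L[ℂ] E} (hS : ρ.IsIntertwiner S) (hT : ρ.IsIntertwiner T) (hSs : IsSelfAdjoint S)
    (hTs : IsSelfAdjoint T) : Commute S T :=
  CyclicRep.commute_of_isFlipProjection
    (fun _ hF => hGK.exists_isFlipProjection hρ.1 hρ.2.1 hF) hS hT hSs.isSymmetric hTs.isSymmetric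

theorem coeff_mem_positiveTypeCone_iff [CompleteSpace E]
    (hGK : IsOlshanskiSphericalPair L ι j K) (hρ : ρ.coeff 1 ∈ positiveTypeCone K)
    {R : E →L[ℂ] E} (hR : ρ.IsIntertwiner R) :
    ρ.coeff R ∈ positiveTypeCone K ↔ 0 ≤ R := by
  rw [← hR.isPositiveType_coeff_iff]
  exact ⟨fun h => h.2.2, fun h => ⟨hGK.continuous_coeff hρ.1 R, CyclicRep.isBiinvariant_coeff
    (fun k hk => CyclicRep.π_v_eq_of_isBiinvariant hρ.2.1 hk) hR, h⟩⟩

end IsOlshanskiSphericalPair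

/-! ### Lattice operations for commuting operators -/

section CStar

variable {A : Type*} [CStarAlgebra A] [PartialOrder A] [StarOrderedRing A]

/-- For commuting elements, `-q ≤ d ≤ q` gives `d ^ 2 ≤ q ^ 2`, hence `|d| ≤ q`, as the square root
is operator monotone. -/
theorem CFC.abs_le_of_commute {d q : A} (hd : IsSelfAdjoint d) (h : Commute d q)
    (h₁ : 0 ≤ q - d) (h₂ : 0 ≤ q + d) : CFC.abs d ≤ q := by
  have hq : 0 ≤ q := by
    have h3 : 0 ≤ (2 : ℝ) • q := by
      have := add_nonneg h₁ h₂
      rwa [sub_add_add_cancel, ← two_smul ℝ] at this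
    simpa using smul_nonneg (by norm_num : (0 : ℝ) ≤ 2⁻¹) h3
  have hc : Commute (q - d) (q + d) :=
    ((Commute.refl q).add_right h.symm).sub_left (h.add_right (Commute.refl d))
  have hsq : star d * d ≤ star q * q := by
    have h3 := hc.mul_nonneg h₁ h₂
    rw [hd.star_eq, hq.isSelfAdjoint.star_eq, ← sub_nonneg]
    convert h3 using 1
    rw [sub_mul, mul_add, mul_add, h.eq]
    abel
  calc CFC.abs d ≤ CFC.abs q := CFC.sqrt_le_sqrt _ _ hsq
    _ = q := CFC.abs_of_nonneg q hq

end CStar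

/-! ### Infima and suprema in the cone -/

open CyclicRep in
/-- Inside the part of the cone dominated by `ω`, the infimum of `x` and `y` is the coefficient
of the operator `(a + b - |a - b|) / 2`, where `a` and `b` represent `x` and `y`. The last clause
says that `x + y - m` is the supremum of `x` and `y` among the functions dominated by `ω`. -/
theorem IsOlshanskiSphericalPair.exists_inf {H : ℕ → Type*} [∀ n, Group (H n)]
    [∀ n, TopologicalSpace (H n)] [∀ n, IsTopologicalGroup (H n)] [∀ n, T2Space (H n)]
    [∀ n, LocallyCompactSpace (H n)] [∀ n, MeasurableSpace (H n)] [∀ n, BorelSpace (H n)]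
    {L : ∀ n, Subgroup (H n)} {ι : ∀ n, H n →* H (n + 1)}
    {G : Type*} [Group G] [TopologicalSpace G] {j : ∀ n, H n →* G} {K : Subgroup G}
    (hGK : IsOlshanskiSphericalPair L ι j K) {ω x y : G → ℂ} (hω : ω ∈ positiveTypeCone K)
    (hx : x ∈ positiveTypeCone K) (hy : y ∈ positiveTypeCone K)
    (hxω : ConeLE (positiveTypeCone K) x ω) (hyω : ConeLE (positiveTypeCone K) y ω) :
    ∃ m ∈ positiveTypeCone K, ConeLE (positiveTypeCone K) m x ∧ ConeLE (positiveTypeCone K) m y ∧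
      (∀ t ∈ positiveTypeCone K, ConeLE (positiveTypeCone K) t x →
        ConeLE (positiveTypeCone K) t y → ConeLE (positiveTypeCone K) t m) ∧
      ∀ t ∈ positiveTypeCone K, ConeLE (positiveTypeCone K) t ω → ConeLE (positiveTypeCone K) x t →
        ConeLE (positiveTypeCone K) y t → ConeLE (positiveTypeCone K) (x + y - m) t := by
  obtain ⟨E, _, _, _, ρ, hρ⟩ := hω.2.2.exists_cyclicRep
  have hρω : ρ.coeff 1 = ω := funext hρ
  have hρ1 : ρ.coeff 1 ∈ positiveTypeCone K := hρω ▸ hω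
  have hrep : ∀ t ∈ positiveTypeCone K, ConeLE (positiveTypeCone K) t ω →
      ∃ R, ρ.IsIntertwiner R ∧ 0 ≤ R ∧ ρ.coeff R = t := fun t ht htω =>
    ρ.exists_coeff_eq ht.2.2 (hρω.symm ▸ htω.2.2)
  have hle : ∀ {R S : E →L[ℂ] E}, ρ.IsIntertwiner R → ρ.IsIntertwiner S →
      (ConeLE (positiveTypeCone K) (ρ.coeff R) (ρ.coeff S) ↔ R ≤ S) := fun hR hS => by
    rw [ConeLE, ← coeff_sub, hGK.coeff_mem_positiveTypeCone_iff hρ1 (hS.sub hR), sub_nonneg]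
  have hcomm : ∀ {R S : E →L[ℂ] E}, ρ.IsIntertwiner R → ρ.IsIntertwiner S → IsSelfAdjoint R →
      IsSelfAdjoint S → Commute R S := fun hR hS hRs hSs =>
    hGK.commute_of_isIntertwiner hρ1 hR hS hRs hSs
  obtain ⟨a, ha, ha0, rfl⟩ := hrep x hx hxω
  obtain ⟨b, hb, hb0, rfl⟩ := hrep y hy hyω
  have hd := ha.sub hb
  have hds : IsSelfAdjoint (a - b) := ha0.isSelfAdjoint.sub hb0.isSelfAdjoint
  have habs : ρ.IsIntertwiner (CFC.abs (a - b)) := fun g z => by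
    have h : Commute (a - b) (ρ.π g) := ContinuousLinearMap.ext fun z => hd g z
    have h' : Commute (CFC.abs (a - b)) (ρ.π g) := by
      refine Commute.cfcₙ_nnreal ?_ _
      rw [hds.star_eq]
      exact h.mul_left h
    exact DFunLike.congr_fun h'.eq z
  set c : E →L[ℂ] E := (2⁻¹ : ℝ) • (a + b - CFC.abs (a - b)) with hc
  have hcI : ρ.IsIntertwiner c := fun g z => by
    have h := ((ha.add hb).sub habs) g z
    simp only [hc, smul_apply, h]
    rw [← Complex.coe_smul, ← Complex.coe_smul, map_smul]
  have h2c : c + c = a + b - CFC.abs (a - b) := by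
    rw [hc, ← two_smul ℝ, smul_smul]
    norm_num
  have half : ∀ {r : E →L[ℂ] E}, 0 ≤ r + r → 0 ≤ r := fun {r} hr => by
    rw [← two_smul ℝ] at hr
    simpa using smul_nonneg (by norm_num : (0 : ℝ) ≤ 2⁻¹) hr
  have hlow : ∀ {s : E →L[ℂ] E}, ρ.IsIntertwiner s → 0 ≤ s → s ≤ a → s ≤ b → s ≤ c := by
    intro s hs hs0 hsa hsb
    -- `|a - b| ≤ a + b - 2 s` is equivalent to `s ≤ c`.
    have h := CFC.abs_le_of_commute (d := a - b) (q := (a - s) + (b - s)) hds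
      (hcomm hd ((ha.sub hs).add (hb.sub hs)) hds
        ((ha0.isSelfAdjoint.sub hs0.isSelfAdjoint).add
          (hb0.isSelfAdjoint.sub hs0.isSelfAdjoint)))
      (by
        convert add_nonneg (sub_nonneg.2 hsb) (sub_nonneg.2 hsb) using 1
        abel)
      (by
        convert add_nonneg (sub_nonneg.2 hsa) (sub_nonneg.2 hsa) using 1
        abel)
    refine sub_nonneg.1 (half ?_)
    convert sub_nonneg.2 h using 1
    rw [sub_add_sub_comm, h2c]
    abel
  have hca : c ≤ a := sub_nonneg.1 <| half <| by
    have h := CFC.abs_add_self (a - b) hds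
    have h' : a - c + (a - c) = CFC.abs (a - b) + (a - b) := by
      rw [sub_add_sub_comm, h2c]
      abel
    rw [h', h]
    exact nsmul_nonneg (CFC.posPart_nonneg _) 2
  have hcb : c ≤ b := sub_nonneg.1 <| half <| by
    have h := CFC.abs_sub_self (a - b) hds
    have h' : b - c + (b - c) = CFC.abs (a - b) - (a - b) := by
      rw [sub_add_sub_comm, h2c]
      abel
    rw [h', h]
    exact nsmul_nonneg (CFC.negPart_nonneg _) 2
  refine ⟨ρ.coeff c, (hGK.coeff_mem_positiveTypeCone_iff hρ1 hcI).2 ?_, (hle hcI ha).2 hca,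
    (hle hcI hb).2 hcb, fun t ht hta htb => ?_, fun t ht htω hat hbt => ?_⟩
  · exact hlow (fun g z => by simp) le_rfl ha0 hb0
  · have htω : ConeLE (positiveTypeCone K) t ω := by
      rw [ConeLE, ← sub_add_sub_cancel ω (ρ.coeff a) t]
      exact (positiveTypeCone K).add_mem hxω hta
    obtain ⟨s, hs, hs0, rfl⟩ := hrep t ht htω
    exact (hle hs hcI).2 (hlow hs hs0 ((hle hs ha).1 hta) ((hle hs hb).1 htb))
  · obtain ⟨s, hs, hs0, rfl⟩ := hrep t ht htω
    rw [← coeff_add, ← coeff_sub]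
    refine (hle ((ha.add hb).sub hcI) hs).2 ?_
    have hsa := (hle ha hs).1 hat
    have hsb := (hle hb hs).1 hbt
    have h := CFC.abs_le_of_commute (d := a - b) (q := (s - a) + (s - b)) hds
      (hcomm hd ((hs.sub ha).add (hs.sub hb)) hds
        ((hs0.isSelfAdjoint.sub ha0.isSelfAdjoint).add
          (hs0.isSelfAdjoint.sub hb0.isSelfAdjoint)))
      (by
        convert add_nonneg (sub_nonneg.2 hsa) (sub_nonneg.2 hsa) using 1
        abel)
      (by
        convert add_nonneg (sub_nonneg.2 hsb) (sub_nonneg.2 hsb) using 1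
        abel)
    refine sub_nonneg.1 (half ?_)
    convert sub_nonneg.2 h using 1
    rw [sub_add_sub_comm, sub_add_sub_comm (a + b), h2c]
    abel

theorem theorem5 {H : ℕ → Type*} [∀ n, Group (H n)] [∀ n, TopologicalSpace (H n)]
    [∀ n, IsTopologicalGroup (H n)] [∀ n, T2Space (H n)] [∀ n, LocallyCompactSpace (H n)]
    [∀ n, MeasurableSpace (H n)] [∀ n, BorelSpace (H n)]
    (L : ∀ n, Subgroup (H n)) (ι : ∀ n, H n →* H (n + 1))
    {G : Type*} [Group G] [TopologicalSpace G] (j : ∀ n, H n →* G) (K : Subgroup G)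
    (hGK : IsOlshanskiSphericalPair L ι j K) :
    IsLatticeCone (positiveTypeCone K) := by
  intro x hx y hy
  have hadd := fun {a b : G → ℂ} => (positiveTypeCone K).add_mem (x := a) (y := b)
  have hxy : x + y ∈ positiveTypeCone K := hadd hx hy
  obtain ⟨m, hm, hmx, hmy, hinf, -⟩ := hGK.exists_inf hxy hx hy
    (by simpa [ConeLE] using hy) (by simpa [ConeLE] using hx)
  refine ⟨⟨x + y - m, ?_, ?_, ?_, fun t ht hxt hyt => ?_⟩, m, hm, hmx, hmy, hinf⟩
  · rw [add_sub_assoc]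
    exact hadd hx hmy
  · rw [ConeLE, add_sub_assoc, add_sub_cancel_left]
    exact hmy
  · rw [ConeLE, add_sub_right_comm, add_sub_cancel_right]
    exact hmx
  · -- The upper bound `t` is compared with the infimum `m'` formed below `x + y + t`; the
    -- maximality of `m` gives `m' ≪ m`.
    obtain ⟨m', hm', hmx', hmy', -, hsup⟩ := hGK.exists_inf (hadd hxy ht) hx hy
      (by
        rw [ConeLE, add_assoc, add_sub_cancel_left]
        exact hadd hy ht)
      (by
        rw [ConeLE, add_right_comm, add_sub_cancel_right]
        exact hadd hx ht)
    have h1 := hsup t ht (by simpa [ConeLE] using hxy) hxt hyt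
    have h2 := hinf m' hm' hmx' hmy'
    have h3 := hadd h1 h2
    rw [ConeLE]
    convert h3 using 1
    abel
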